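/- Let $G=(V,E)$ be a finite directed graph (self-loops allowed) with out-matrix $H$: $H(v,u)>0$ if $(v,u)\in E$, $H(v,u)=0$ otherwise, and $\sum_{u}H(v,u)=1$ for every $v\in V$. A configuration $s$ assigns to each node one of the states agnostic, red, blue (the last two are called gnostic). Consider the pull voter model with agnostic nodes, i.e. the Markov chain $(S_t)_{t\ge 0}$ of configurations with the following rounds. When a node $v$ pulls, it chooses a node $u$ with probability $H(v,u)$; if $u$ is agnostic, $v$ keeps its state, and if $u$ is gnostic, $v$ adopts the colour of $u$. In the synchronous model all nodes pull simultaneously and independently in each round; in the asynchronous model a single node, chosen uniformly at random, pulls in each round. Let $\mu=(\mu(v))_{v\in V}$ be a real row vector with $\mu H=\mu$, and suppose that $H$ is reversible with respect to $\mu$: $\mu(v)H(v,w)=\mu(w)H(w,v)$ for all $v,w\in V$. For $t\ge 0$ let $R_t(v)$ be the event that the state of $v$ at the first time $k\ge t$ at which $v$ is gnostic exists and is red (so, if $v$ is gnostic at time $t$, the event that $v$ is red at time $t$), and put $$X_t=\sum_{v\in V}\mu(v)\,\mathbb P\bigl(R_t(v)\mid S_t\bigr).$$ Then, in the synchronous and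 in the asynchronous model and for every law of $S_0$, $(X_t)_{t\ge0}$ is a martingale with respect to the filtration generated by $(S_t)_{t\ge 0}$. Moreover, suppose that $\sum_v\mu(v)=1$ and that the process converges almost surely, i.e. almost surely there is a time $t$ at which all nodes are in the same state. Then $\mathbb P(\text{red wins}\mid S_0)=X_0$ almost surely, where red wins if at some time all nodes are red. In particular, if the initial configuration $S_0$ is deterministic, then $\mathbb P(\text{red wins})=X_0$ (almost surely). -/

import Mathlib

open MeasureTheory ProbabilityTheory

/-- The state of a node: agnostic (white), or gnostic with colour red or blue. -/
inductive Opinion where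
  | agnostic
  | red
  | blue
  deriving DecidableEq

namespace AgnosticVoter

instance : MeasurableSpace Opinion := ⊤

/-- Synchronous protocol: every node pulls in each round.  Asynchronous protocol: one node, chosen
uniformly at random, pulls in each round. -/
inductive Protocol where
  | synchronous
  | asynchronous

/-- A configuration assigns a state to each node. -/
abbrev Config (V : Type*) := V → Opinion

/-- `H` is the out-matrix of the weighted directed graph `G` (self-loops allowed): the edges are
exactly the pairs of positive weight, and the weights of the edges leaving a node sum to `1`. -/
structure IsOutMatrix {V : Type*} [Fintype V] (G : Digraph V) (H : Matrix V V ℝ) : Prop where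
  pos_of_adj : ∀ v u, G.Adj v u → 0 < H v u
  zero_of_not_adj : ∀ v u, ¬ G.Adj v u → H v u = 0
  sum_row : ∀ v, ∑ u, H v u = 1

/-- The new state of a node in state `own` that has chosen a neighbour in state `seen`. -/
def pull (own : Opinion) : Opinion → Opinion
  | .agnostic => own
  | .red => .red
  | .blue => .blue

/-- The configuration after a synchronous round in which each node `v` has chosen node `c v`. -/
def syncUpdate {V : Type*} (s : Config V) (c : V → V) : Config V :=
  fun v => pull (s v) (s (c v))

/-- The configuration after an asynchronous round in which node `v` has been selected and has
chosen node `u`. -/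
def asyncUpdate {V : Type*} [DecidableEq V] (s : Config V) (v u : V) : Config V :=
  Function.update s v (pull (s v) (s u))

/-- The one-round transition probability from `s` to `s'`.  In the synchronous case the choices of
the nodes are independent and node `v` chooses `u` with probability `H v u`; in the asynchronous
case a uniformly random node `v` is selected and chooses `u` with probability `H v u`. -/
noncomputable def stepProb {V : Type*} [Fintype V] [DecidableEq V] (H : Matrix V V ℝ) :
    Protocol → Config V → Config V → ℝ
  | .synchronous, s, s' =>
      ∑ c : V → V, if syncUpdate s c = s' then ∏ v, H v (c v) else 0
  | .asynchronous, s, s' =>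
      ∑ v : V, ∑ u : V, if asyncUpdate s v u = s' then (Fintype.card V : ℝ)⁻¹ * H v u else 0

/-- `S` is a pull voter model with agnostic nodes: the time-homogeneous Markov chain with the
transition probabilities `stepProb H π`, started from an arbitrary initial law. -/
structure IsVoterModel {V Ω : Type*} [Fintype V] [DecidableEq V] [MeasurableSpace Ω]
    (H : Matrix V V ℝ) (π : Protocol) (P : Measure Ω) (S : ℕ → Ω → Config V) : Prop where
  measurable : ∀ t, Measurable (S t)
  markov : ∀ (t : ℕ) (s : ℕ → Config V),
    P.real {ω | ∀ k ≤ t + 1, S k ω = s k} =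
      P.real {ω | ∀ k ≤ t, S k ω = s k} * stepProb H π (s t) (s (t + 1))

/-- The σ-algebra generated by `S t`. -/
abbrev sigmaAt {V Ω : Type*} (S : ℕ → Ω → Config V) (t : ℕ) : MeasurableSpace Ω :=
  MeasurableSpace.comap (S t) inferInstance

/-- The filtration generated by the process `S`. -/
def history {V Ω : Type*} [mΩ : MeasurableSpace Ω] (S : ℕ → Ω → Config V)
    (hS : ∀ t, Measurable (S t)) : Filtration ℕ mΩ where
  seq t := ⨆ k ≤ t, sigmaAt S k
  mono' := fun _ _ hij => biSup_mono fun _ hk => hk.trans hij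
  le' := fun _ => iSup₂_le fun k _ => (hS k).comap_le

/-- The event, for the process observed from time `t` on, that node `v` is coloured red once it is
gnostic: the first gnostic state of `v` at a time `k ≥ t` is red. In particular, if `v` is gnostic
at time `t`, the event says that `v` is red at time `t`. -/
def redOnceGnostic {V Ω : Type*} (S : ℕ → Ω → Config V) (t : ℕ) (v : V) : Set Ω :=
  {ω | ∃ k, t ≤ k ∧ S k ω v = .red ∧ ∀ j, t ≤ j → j < k → S j ω v = .agnostic}

/-- `X t = ∑ v, μ v * P(R(v) | S t)`. -/
noncomputable def redInfluence {V Ω : Type*} [Fintype V] [MeasurableSpace Ω]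
    (μ : V → ℝ) (P : Measure Ω) (S : ℕ → Ω → Config V) (t : ℕ) (ω : Ω) : ℝ :=
  ∑ v, μ v * (P⟦redOnceGnostic S t v | sigmaAt S t⟧) ω

/-- The event that red wins: the configuration with all nodes red is reached. -/
def redWins {V Ω : Type*} (S : ℕ → Ω → Config V) : Set Ω :=
  {ω | ∃ t, ∀ v, S t ω v = .red}

/-- The process converges almost surely: consensus (all nodes in the same state) is reached. -/
def Converges {V Ω : Type*} [MeasurableSpace Ω] (P : Measure Ω) (S : ℕ → Ω → Config V) : Prop :=
  ∀ᵐ ω ∂P, ∃ (t : ℕ) (c : Opinion), ∀ v, S t ω v = c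

end AgnosticVoter

namespace AgnosticVoter

open Filter Topology

/-! By the Markov property, `P(R_t(v) | S_t)` is `r_v(S_t)`, where `r_v(s)` (`redProb`) is the
chance that the first gnostic state of `v`, started from `s`, is red. So `X_t = h(S_t)` almost
surely with `h = ∑ v, μ v * r_v`, and the martingale property reduces to `h` being harmonic for one
round.

If `v` is agnostic in `s`, then `r_v` is harmonic at `s` by first-step analysis. If `v` is gnostic
it stays so, `r_v` is the indicator of red, and its mean change is the pull rate times `∑ H v u *
(1[u red] - 1[v red])` over gnostic `u`. Weighted by `μ v`, these terms are antisymmetric in `v, u`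
by reversibility, so they cancel (`stepMean_sum_mul_redProb`). Only the law of a single node's pull
enters, so the protocols differ by a rate that is the same for all nodes.

Consensus is absorbing, and there `h` is `1` if the colour is red and `0` otherwise, because `∑ v, μ
v = 1`. Hence `h(S_t)` converges boundedly to the indicator of a red win, and dominated convergence
identifies its conditional probability with `X_0`. -/

instance : Fintype Opinion :=
  ⟨{.agnostic, .red, .blue}, by rintro (_ | _ | _) <;> simp⟩

/-! ### One round of the model as an operator on functions of configurations -/

section Transition

variable {V : Type*} [Fintype V] [DecidableEq V] {H : Matrix V V ℝ} {π : Protocol}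

/-- The expectation of `f` after one round started from `s`. -/
noncomputable def stepMean (H : Matrix V V ℝ) (π : Protocol) (f : Config V → ℝ)
    (s : Config V) : ℝ :=
  ∑ s', stepProb H π s s' * f s'

/-- The probability that a given node pulls in a given round. -/
noncomputable def pullRate (V : Type*) [Fintype V] : Protocol → ℝ
  | .synchronous => 1
  | .asynchronous => (Fintype.card V : ℝ)⁻¹

theorem stepMean_synchronous (f : Config V → ℝ) (s : Config V) :
    stepMean H .synchronous f s = ∑ c : V → V, (∏ v, H v (c v)) * f (syncUpdate s c) := by
  simp only [stepMean, stepProb, Finset.sum_mul]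
  rw [Finset.sum_comm]
  simp [ite_mul]

theorem stepMean_asynchronous (f : Config V → ℝ) (s : Config V) :
    stepMean H .asynchronous f s =
      ∑ v, ∑ u, (Fintype.card V : ℝ)⁻¹ * H v u * f (asyncUpdate s v u) := by
  simp only [stepMean, stepProb, Finset.sum_mul]
  rw [Finset.sum_comm]
  refine Finset.sum_congr rfl fun v _ => ?_
  rw [Finset.sum_comm]
  simp [ite_mul]

/-- The choices of all nodes other than `v` integrate out because rows sum to one. This is where the
two protocols become one formula. -/
theorem stepMean_comp_eval (hrow : ∀ v, ∑ u, H v u = 1) (f : Opinion → ℝ) (v : V)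
    (s : Config V) :
    stepMean H π (fun s' => f (s' v)) s =
      (1 - pullRate V π) * f (s v) +
        pullRate V π * ∑ u, H v u * f (pull (s v) (s u)) := by
  cases π with
  | synchronous =>
    -- A product of row sums, with `f` inserted in row `v` only, expands into the sum over all joint
    -- choices `c`.
    have key := Fintype.prod_sum
      (fun w u => H w u * if w = v then f (pull (s v) (s u)) else 1)
    simp only [Finset.prod_mul_distrib, Finset.prod_ite_eq', Finset.mem_univ, if_true] at key
    rw [stepMean_synchronous]
    simp only [syncUpdate, pullRate]
    rw [← key, ← Finset.mul_prod_erase _ _ (Finset.mem_univ v), Finset.prod_eq_one]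
    · simp
    · intro w hw
      simp [Finset.ne_of_mem_erase hw, hrow]
  | asynchronous =>
    have hcard : (Fintype.card V : ℝ) ≠ 0 :=
      Nat.cast_ne_zero.2 (Fintype.card_pos_iff.2 ⟨v⟩).ne'
    rw [stepMean_asynchronous, ← Finset.add_sum_erase _ _ (Finset.mem_univ v)]
    have hne : ∀ w ∈ Finset.univ.erase v,
        ∑ u, (Fintype.card V : ℝ)⁻¹ * H w u * f (asyncUpdate s w u v) =
          (Fintype.card V : ℝ)⁻¹ * f (s v) := by
      intro w hw
      simp only [asyncUpdate, Function.update_of_ne (Finset.ne_of_mem_erase hw).symm]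
      rw [← Finset.sum_mul, ← Finset.mul_sum, hrow, mul_one]
    rw [Finset.sum_congr rfl hne, Finset.sum_const, Finset.card_erase_of_mem (Finset.mem_univ v),
      Finset.card_univ, nsmul_eq_mul, Nat.cast_sub (Fintype.card_pos_iff.2 ⟨v⟩)]
    simp only [asyncUpdate, Function.update_self, pullRate, Finset.mul_sum]
    rw [add_comm]
    congr 1
    · field_simp
      simp [mul_comm]
    · simp only [mul_assoc]

/-- A node is needed: without one, the asynchronous kernel is an empty sum of mass zero. -/
theorem stepMean_const [Nonempty V] (hrow : ∀ v, ∑ u, H v u = 1) (a : ℝ) (s : Config V) :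
    stepMean H π (fun _ => a) s = a := by
  obtain ⟨v⟩ := ‹Nonempty V›
  rw [stepMean_comp_eval hrow (fun _ => a) v s, ← Finset.sum_mul, hrow]
  ring

theorem stepProb_nonneg (hH : ∀ v u, 0 ≤ H v u) (s s' : Config V) :
    0 ≤ stepProb H π s s' := by
  cases π with
  | synchronous =>
    refine Finset.sum_nonneg fun c _ => ?_
    split_ifs
    exacts [Finset.prod_nonneg fun v _ => hH v _, le_rfl]
  | asynchronous =>
    refine Finset.sum_nonneg fun v _ => Finset.sum_nonneg fun u _ => ?_
    split_ifs
    exacts [mul_nonneg (by positivity) (hH v u), le_rfl]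

/-- In a possible transition, each node keeps its state or pulls the state of some node. -/
theorem eq_or_exists_pull_of_stepProb_ne_zero {s s' : Config V} (h : stepProb H π s s' ≠ 0)
    (v : V) : s' v = s v ∨ ∃ u, s' v = pull (s v) (s u) := by
  cases π with
  | synchronous =>
    obtain ⟨c, -, hc⟩ := Finset.exists_ne_zero_of_sum_ne_zero h
    obtain ⟨rfl, -⟩ := ite_ne_right_iff.1 hc
    exact .inr ⟨c v, rfl⟩
  | asynchronous =>
    obtain ⟨w, -, hw⟩ := Finset.exists_ne_zero_of_sum_ne_zero h
    obtain ⟨u, -, hu⟩ := Finset.exists_ne_zero_of_sum_ne_zero hw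
    obtain ⟨rfl, -⟩ := ite_ne_right_iff.1 hu
    by_cases hvw : v = w
    · subst hvw
      exact .inr ⟨u, by simp [asyncUpdate]⟩
    · exact .inl (by simp [asyncUpdate, hvw])

theorem pull_self (a : Opinion) : pull a a = a := by
  cases a <;> rfl

theorem pull_ne_agnostic {a : Opinion} (ha : a ≠ .agnostic) (b : Opinion) :
    pull a b ≠ .agnostic := by
  cases b <;> simp [pull, ha]

theorem eq_const_of_stepProb_ne_zero {c : Opinion} {s' : Config V}
    (h : stepProb H π (fun _ => c) s' ≠ 0) : s' = fun _ => c := by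
  funext v
  obtain hv | ⟨_, hv⟩ := eq_or_exists_pull_of_stepProb_ne_zero h v
  · exact hv
  · rw [hv, pull_self]

theorem ne_agnostic_of_stepProb_ne_zero {s s' : Config V} (h : stepProb H π s s' ≠ 0) {v : V}
    (hv : s v ≠ .agnostic) : s' v ≠ .agnostic := by
  obtain h' | ⟨u, h'⟩ := eq_or_exists_pull_of_stepProb_ne_zero h v
  · rwa [h']
  · rw [h']
    exact pull_ne_agnostic hv _

theorem stepMean_congr {f g : Config V → ℝ} {s : Config V}
    (h : ∀ s', stepProb H π s s' ≠ 0 → f s' = g s') : stepMean H π f s = stepMean H π g s := by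
  refine Finset.sum_congr rfl fun s' _ => ?_
  by_cases hs : stepProb H π s s' = 0
  · simp [hs]
  · rw [h s' hs]

theorem stepMean_mono (hH : ∀ v u, 0 ≤ H v u) {f g : Config V → ℝ} (h : ∀ s, f s ≤ g s)
    (s : Config V) : stepMean H π f s ≤ stepMean H π g s :=
  Finset.sum_le_sum fun s' _ => mul_le_mul_of_nonneg_left (h s') (stepProb_nonneg hH s s')

theorem stepMean_sum_mul (μ : V → ℝ) (f : V → Config V → ℝ) (s : Config V) :
    stepMean H π (fun s' => ∑ v, μ v * f v s') s = ∑ v, μ v * stepMean H π (f v) s := by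
  simp only [stepMean, Finset.mul_sum]
  rw [Finset.sum_comm]
  exact Finset.sum_congr rfl fun v _ => Finset.sum_congr rfl fun s' _ => by ring

/-! ### The probability that the first gnostic state is red -/

/-- The probability, for the model started from `s`, that `v` becomes gnostic within `n` rounds
and that its first gnostic state is red. -/
noncomputable def redProbWithin (H : Matrix V V ℝ) (π : Protocol) (v : V) :
    ℕ → Config V → ℝ
  | 0, s => if s v = .red then 1 else 0
  | n + 1, s =>
      if s v = .red then 1
      else if s v = .agnostic then stepMean H π (redProbWithin H π v n) s else 0

/-- The probability, for the model started from `s`, that the first gnostic state of `v` exists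
and is red. -/
noncomputable def redProb (H : Matrix V V ℝ) (π : Protocol) (v : V) (s : Config V) : ℝ :=
  ⨆ n, redProbWithin H π v n s

theorem redProbWithin_of_red {v : V} {s : Config V} (h : s v = .red) (n : ℕ) :
    redProbWithin H π v n s = 1 := by
  cases n <;> simp [redProbWithin, h]

theorem redProbWithin_of_blue {v : V} {s : Config V} (h : s v = .blue) (n : ℕ) :
    redProbWithin H π v n s = 0 := by
  cases n <;> simp [redProbWithin, h]

theorem redProbWithin_nonneg (hH : ∀ v u, 0 ≤ H v u) (v : V) (n : ℕ) (s : Config V) :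
    0 ≤ redProbWithin H π v n s := by
  induction n generalizing s with
  | zero => rw [redProbWithin]; split_ifs <;> norm_num
  | succ n ih =>
    rw [redProbWithin]
    split_ifs
    exacts [zero_le_one,
      Finset.sum_nonneg fun s' _ => mul_nonneg (stepProb_nonneg hH s s') (ih s'), le_rfl]

theorem redProbWithin_le_one (hH : ∀ v u, 0 ≤ H v u) (hrow : ∀ v, ∑ u, H v u = 1) (v : V)
    (n : ℕ) (s : Config V) : redProbWithin H π v n s ≤ 1 := by
  have : Nonempty V := ⟨v⟩
  induction n generalizing s with
  | zero => rw [redProbWithin]; split_ifs <;> norm_num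
  | succ n ih =>
    rw [redProbWithin]
    split_ifs
    exacts [le_rfl, (stepMean_mono hH ih s).trans_eq (stepMean_const hrow 1 s), zero_le_one]

theorem redProbWithin_le_succ (hH : ∀ v u, 0 ≤ H v u) (v : V) (n : ℕ) (s : Config V) :
    redProbWithin H π v n s ≤ redProbWithin H π v (n + 1) s := by
  induction n generalizing s with
  | zero =>
    rw [redProbWithin]
    split_ifs with h
    exacts [(redProbWithin_of_red h _).ge, redProbWithin_nonneg hH _ _ _]
  | succ n ih =>
    rw [redProbWithin, redProbWithin]
    split_ifs
    exacts [le_rfl, stepMean_mono hH ih s, le_rfl]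

theorem tendsto_redProbWithin (hH : ∀ v u, 0 ≤ H v u) (hrow : ∀ v, ∑ u, H v u = 1) (v : V)
    (s : Config V) :
    Tendsto (fun n => redProbWithin H π v n s) atTop (𝓝 (redProb H π v s)) :=
  tendsto_atTop_ciSup (monotone_nat_of_le_succ fun n => redProbWithin_le_succ hH v n s)
    ⟨1, by rintro _ ⟨n, rfl⟩; exact redProbWithin_le_one hH hrow v n s⟩

theorem redProb_of_red {v : V} {s : Config V} (h : s v = .red) : redProb H π v s = 1 := by
  simp [redProb, redProbWithin_of_red h]

theorem redProb_of_blue {v : V} {s : Config V} (h : s v = .blue) : redProb H π v s = 0 := by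
  simp [redProb, redProbWithin_of_blue h]

theorem redProb_of_ne_agnostic {v : V} {s : Config V} (h : s v ≠ .agnostic) :
    redProb H π v s = if s v = .red then 1 else 0 := by
  cases hs : s v with
  | agnostic => exact absurd hs h
  | red => simp [redProb_of_red hs]
  | blue => simp [redProb_of_blue hs]

/-- The all-agnostic configuration is absorbing. It counts as a consensus, so its value is needed in
the analysis of winning. -/
theorem redProb_const_agnostic (v : V) : redProb H π v (fun _ => .agnostic) = 0 := by
  have h : ∀ n, redProbWithin H π v n (fun _ => .agnostic) = 0 := by
    intro n
    induction n with
    | zero => simp [redProbWithin]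
    | succ n ih =>
      simp only [redProbWithin, reduceCtorEq, if_false, if_true]
      rw [stepMean_congr (g := fun _ => 0)]
      · simp [stepMean]
      · intro s' hs'
        rw [eq_const_of_stepProb_ne_zero hs', ih]
  simp [redProb, h]

theorem redProb_const (v : V) (c : Opinion) :
    redProb H π v (fun _ => c) = if c = .red then 1 else 0 := by
  cases c with
  | agnostic => simp [redProb_const_agnostic]
  | red => simp [redProb_of_red]
  | blue => simp [redProb_of_blue]

/-- First-step analysis: the recursion for `redProbWithin` passes to the limit in `n`, as the mean
is a finite sum. -/
theorem stepMean_redProb_of_agnostic (hH : ∀ v u, 0 ≤ H v u) (hrow : ∀ v, ∑ u, H v u = 1)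
    {v : V} {s : Config V} (h : s v = .agnostic) :
    stepMean H π (redProb H π v) s = redProb H π v s := by
  have h₁ : Tendsto (fun n => stepMean H π (redProbWithin H π v n) s) atTop
      (𝓝 (stepMean H π (redProb H π v) s)) :=
    tendsto_finsetSum _ fun s' _ => (tendsto_redProbWithin hH hrow v s').const_mul _
  refine tendsto_nhds_unique h₁ ?_
  refine ((tendsto_add_atTop_iff_nat 1).2 (tendsto_redProbWithin hH hrow v s)).congr fun n => ?_
  simp [redProbWithin, h]

/-- A gnostic node stays gnostic, so `redProb` is the red indicator before and after the round;
pulling an agnostic node changes nothing. -/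
theorem stepMean_redProb_of_ne_agnostic (hrow : ∀ v, ∑ u, H v u = 1) {v : V} {s : Config V}
    (h : s v ≠ .agnostic) :
    stepMean H π (redProb H π v) s = redProb H π v s + pullRate V π *
      ∑ u, if s u = .agnostic then 0 else
        H v u * ((if s u = .red then 1 else 0) - if s v = .red then 1 else 0) := by
  have key := stepMean_comp_eval (π := π) hrow (fun a => if a = .red then 1 else 0) v s
  rw [stepMean_congr fun s' hs' =>
    redProb_of_ne_agnostic (ne_agnostic_of_stepProb_ne_zero hs' h), key,
    redProb_of_ne_agnostic h]
  have hsum : (∑ u, if s u = .agnostic then 0 else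
        H v u * ((if s u = .red then 1 else 0) - if s v = .red then 1 else 0)) =
      (∑ u, H v u * if pull (s v) (s u) = .red then 1 else 0) -
        if s v = .red then 1 else 0 := by
    have hself : (if s v = .red then 1 else 0 : ℝ) =
        ∑ u, H v u * if s v = .red then 1 else 0 := by
      rw [← Finset.sum_mul, hrow, one_mul]
    conv_rhs => rw [hself]
    rw [← Finset.sum_sub_distrib]
    refine Finset.sum_congr rfl fun u _ => ?_
    cases s u <;> cases s v <;> simp [pull]
  rw [hsum]
  ring

/-- The total red influence of a configuration is harmonic for reversible out-matrices. -/
theorem stepMean_sum_mul_redProb (hH : ∀ v u, 0 ≤ H v u) (hrow : ∀ v, ∑ u, H v u = 1)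
    {μ : V → ℝ} (hrev : ∀ v w, H v w * μ v = H w v * μ w) (s : Config V) :
    stepMean H π (fun s' => ∑ v, μ v * redProb H π v s') s = ∑ v, μ v * redProb H π v s := by
  -- The weighted change at `v` due to `u`, kept only when both are gnostic. Rows of agnostic `v`
  -- can be zeroed because `redProb` is already harmonic there; this makes `φ` antisymmetric.
  let φ : V → V → ℝ := fun v u =>
    if s v = .agnostic then 0 else if s u = .agnostic then 0 else
      μ v * H v u * ((if s u = .red then 1 else 0) - if s v = .red then 1 else 0)
  have hanti : ∀ v u, φ v u = -φ u v := by
    intro v u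
    simp only [φ]
    rw [mul_comm (μ v), mul_comm (μ u), hrev v u]
    split_ifs <;> ring
  have hφ : ∑ v, ∑ u, φ v u = 0 := by
    have : ∑ v, ∑ u, φ v u = -∑ v, ∑ u, φ v u := by
      conv_lhs => rw [Finset.sum_comm]
      simp only [← Finset.sum_neg_distrib]
      exact Finset.sum_congr rfl fun v _ => Finset.sum_congr rfl fun u _ => hanti u v
    linarith
  have hv : ∀ v, μ v * stepMean H π (redProb H π v) s =
      μ v * redProb H π v s + pullRate V π * ∑ u, φ v u := by
    intro v
    by_cases h : s v = .agnostic
    · simp [φ, h, stepMean_redProb_of_agnostic hH hrow h]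
    · rw [stepMean_redProb_of_ne_agnostic hrow h, mul_add, mul_left_comm, Finset.mul_sum]
      simp only [φ, h, if_false, mul_ite, mul_zero, mul_assoc]
  rw [stepMean_sum_mul, Finset.sum_congr rfl fun v _ => hv v, Finset.sum_add_distrib,
    ← Finset.mul_sum, hφ, mul_zero, add_zero]

end Transition

/-! ### The Markov property on path space -/

section Chain

variable {V Ω : Type*} [Fintype V] [DecidableEq V] [mΩ : MeasurableSpace Ω] {P : Measure Ω}
  [IsProbabilityMeasure P] {H : Matrix V V ℝ} {π : Protocol} {S : ℕ → Ω → Config V}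

omit [DecidableEq V] [Fintype V] in
theorem sigmaAt_le_history (hm : ∀ t, Measurable (S t)) (t : ℕ) :
    sigmaAt S t ≤ history S hm t :=
  le_iSup₂_of_le (f := fun k (_ : k ≤ t) => sigmaAt S k) t le_rfl le_rfl

omit [DecidableEq V] mΩ in
theorem stronglyMeasurable_sigmaAt_comp (S : ℕ → Ω → Config V) (f : Config V → ℝ) (t : ℕ) :
    StronglyMeasurable[sigmaAt S t] fun ω => f (S t ω) :=
  ((measurable_of_finite f).comp (comap_measurable (S t))).stronglyMeasurable

omit [DecidableEq V] in
theorem integrable_comp (hm : ∀ t, Measurable (S t)) (f : Config V → ℝ) (t : ℕ) :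
    Integrable (fun ω => f (S t ω)) P :=
  (Integrable.of_finite (f := f) (μ := P.map (S t))).comp_measurable (hm t)

omit [DecidableEq V] in
theorem measurableSet_path (hm : ∀ t, Measurable (S t)) (t : ℕ) (s : ℕ → Config V) :
    MeasurableSet {ω | ∀ k ≤ t, S k ω = s k} := by
  simp only [Set.ofPred_forall]
  exact .iInter fun k => .iInter fun _ => hm k (measurableSet_singleton (s k))

/-- On a path cylinder `S t` is constant, so both sides are finite sums over the next configuration,
matched term by term by `markov`. -/
theorem setIntegral_path_comp_succ (hS : IsVoterModel H π P S) (f : Config V → ℝ) (t : ℕ)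
    (s : ℕ → Config V) :
    ∫ ω in {ω | ∀ k ≤ t, S k ω = s k}, f (S (t + 1) ω) ∂P =
      ∫ ω in {ω | ∀ k ≤ t, S k ω = s k}, stepMean H π f (S t ω) ∂P := by
  have hmeas := measurableSet_path hS.measurable t s
  have hconst : Set.EqOn (fun ω => stepMean H π f (S t ω)) (fun _ => stepMean H π f (s t))
      {ω | ∀ k ≤ t, S k ω = s k} := fun ω hω => congrArg _ (hω t le_rfl)
  rw [setIntegral_congr_fun hmeas hconst, setIntegral_const,
    ← integral_map (f := f) (hS.measurable (t + 1)).aemeasurable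
      (measurable_of_finite f).aestronglyMeasurable, integral_fintype .of_finite, stepMean,
    Finset.smul_sum]
  refine Finset.sum_congr rfl fun s' _ => ?_
  have h := hS.markov t (Function.update s (t + 1) s')
  have hne : ∀ k ≤ t, Function.update s (t + 1) s' k = s k := fun k hk =>
    Function.update_of_ne (by omega) _ _
  have h₁ : {ω | ∀ k ≤ t + 1, S k ω = Function.update s (t + 1) s' k} =
      S (t + 1) ⁻¹' {s'} ∩ {ω | ∀ k ≤ t, S k ω = s k} := by
    ext ω
    constructor
    · intro hω
      refine ⟨by simpa using hω (t + 1) le_rfl, fun k hk => ?_⟩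
      rw [hω k (by omega), hne k hk]
    · rintro ⟨h₁, h₂⟩ k hk
      obtain rfl | hk := hk.eq_or_lt
      · simpa using h₁
      · rw [hne k (by omega), h₂ k (by omega)]
  have h₂ : {ω | ∀ k ≤ t, S k ω = Function.update s (t + 1) s' k} =
      {ω | ∀ k ≤ t, S k ω = s k} := by
    ext ω
    exact forall₂_congr fun k hk => by rw [hne k hk]
  rw [h₁, h₂, hne t le_rfl, Function.update_self] at h
  rw [map_measureReal_apply (hS.measurable _) (measurableSet_singleton s'),
    measureReal_restrict_apply (hS.measurable _ (measurableSet_singleton s')), h]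
  simp only [smul_eq_mul]
  ring

/-- The path extending a finite path periodically. -/
def extendPath {t : ℕ} (b : Fin (t + 1) → Config V) (k : ℕ) : Config V :=
  b (Fin.ofNat (t + 1) k)

omit [Fintype V] [DecidableEq V] mΩ in
theorem forall_le_eq_extendPath_iff {t : ℕ} (b : Fin (t + 1) → Config V) (ω : Ω) :
    (∀ k ≤ t, S k ω = extendPath b k) ↔ (fun k : Fin (t + 1) => S k ω) = b := by
  rw [funext_iff]
  constructor
  · intro h k
    rw [h k (by omega), extendPath, Fin.ofNat_val_eq_self]
  · intro h k hk
    have h' := h (Fin.ofNat (t + 1) k)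
    rwa [Fin.val_ofNat, Nat.mod_eq_of_lt (by omega)] at h'

/-- The Markov property for one round. -/
theorem condExp_comp_succ (hS : IsVoterModel H π P S) (f : Config V → ℝ) (t : ℕ) :
    P[fun ω => f (S (t + 1) ω) | history S hS.measurable t] =ᵐ[P]
      fun ω => stepMean H π f (S t ω) := by
  classical
  have hint := integrable_comp (P := P) hS.measurable f (t + 1)
  have hint' := integrable_comp (P := P) hS.measurable (stepMean H π f) t
  refine (ae_eq_condExp_of_forall_setIntegral_eq ((history S hS.measurable).le t) hint
    (fun _ _ _ => hint'.integrableOn) (fun E hE _ => ?_)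
    ((stronglyMeasurable_sigmaAt_comp S (stepMean H π f) t).mono
      (sigmaAt_le_history hS.measurable t)).aestronglyMeasurable).symm
  let J : Ω → Fin (t + 1) → Config V := fun ω k => S k ω
  -- The initial segment `J` takes finitely many values, so each event of the history is a finite
  -- disjoint union of path cylinders.
  have hle : history S hS.measurable t ≤ MeasurableSpace.comap J inferInstance :=
    iSup₂_le fun k hk => by
      have : Measurable[MeasurableSpace.comap J inferInstance] (S k) :=
        (measurable_pi_apply (⟨k, by omega⟩ : Fin (t + 1))).comp (comap_measurable J)
      exact this.comap_le
  obtain ⟨B, -, rfl⟩ := hle E hE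
  have hB : J ⁻¹' B = ⋃ b ∈ B.toFinset, {ω | ∀ k ≤ t, S k ω = extendPath b k} := by
    ext ω
    simp [forall_le_eq_extendPath_iff, J]
  have hdisj : Set.Pairwise (B.toFinset : Set (Fin (t + 1) → Config V))
      (Function.onFun Disjoint fun b => {ω | ∀ k ≤ t, S k ω = extendPath b k}) := by
    refine fun b _ b' _ hbb' => Set.disjoint_left.2 fun ω h h' => hbb' ?_
    exact ((forall_le_eq_extendPath_iff b ω).1 h).symm.trans
      ((forall_le_eq_extendPath_iff b' ω).1 h')
  rw [hB, integral_biUnion_finset _ (fun b _ => measurableSet_path hS.measurable t _) hdisj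
      fun _ _ => hint'.integrableOn,
    integral_biUnion_finset _ (fun b _ => measurableSet_path hS.measurable t _) hdisj
      fun _ _ => hint.integrableOn]
  exact Finset.sum_congr rfl fun b _ => (setIntegral_path_comp_succ hS f t _).symm

/-- Almost surely, only transitions of positive probability occur. -/
theorem ae_stepProb_ne_zero (hS : IsVoterModel H π P S) :
    ∀ᵐ ω ∂P, ∀ t, stepProb H π (S t ω) (S (t + 1) ω) ≠ 0 := by
  rw [ae_all_iff]
  intro t
  -- There are finitely many segments `b`, and each one ending in an impossible transition has a
  -- null cylinder.
  have hpath : ∀ᵐ ω ∂P, ∀ b : Fin (t + 2) → Config V,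
      stepProb H π (extendPath b t) (extendPath b (t + 1)) = 0 →
        ¬ ∀ k ≤ t + 1, S k ω = extendPath b k := by
    rw [ae_all_iff]
    intro b
    by_cases hb : stepProb H π (extendPath b t) (extendPath b (t + 1)) = 0
    swap
    · exact ae_of_all _ fun _ h => absurd h hb
    have h := hS.markov t (extendPath b)
    rw [hb, mul_zero, measureReal_eq_zero_iff] at h
    filter_upwards [measure_eq_zero_iff_ae_notMem.1 h] with ω hω _ using hω
  filter_upwards [hpath] with ω hω hzero
  have h := (forall_le_eq_extendPath_iff (S := S) (fun k : Fin (t + 2) => S k ω) ω).2 rfl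
  refine hω _ ?_ h
  rwa [← h t (by omega), ← h (t + 1) le_rfl]

/-! ### Conditional probabilities of the red events -/

/-- The event that `v` becomes gnostic at one of the times `t, …, t + n` and that its first
gnostic state from time `t` on is red. -/
def redOnceGnosticWithin (S : ℕ → Ω → Config V) (v : V) (n t : ℕ) : Set Ω :=
  {ω | ∃ k, t ≤ k ∧ k ≤ t + n ∧ S k ω v = .red ∧ ∀ j, t ≤ j → j < k → S j ω v = .agnostic}

omit [Fintype V] [DecidableEq V] in
theorem measurableSet_redOnceGnosticWithin (hm : ∀ t, Measurable (S t)) (v : V) (n t : ℕ) :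
    MeasurableSet (redOnceGnosticWithin S v n t) := by
  have hev : ∀ k (a : Opinion), MeasurableSet {ω | S k ω v = a} := fun k a =>
    (measurable_pi_apply v).comp (hm k) (measurableSet_singleton a)
  simp only [redOnceGnosticWithin, Set.ofPred_exists, Set.ofPred_and, Set.ofPred_forall]
  exact .iUnion fun k => (MeasurableSet.const _).inter <| (MeasurableSet.const _).inter <|
    (hev k _).inter <| .iInter fun j => .iInter fun _ => .iInter fun _ => hev j _

omit [Fintype V] [DecidableEq V] mΩ in
theorem iUnion_redOnceGnosticWithin (v : V) (t : ℕ) :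
    ⋃ n, redOnceGnosticWithin S v n t = redOnceGnostic S t v := by
  ext ω
  simp only [Set.mem_iUnion, redOnceGnosticWithin, redOnceGnostic, Set.mem_ofPred_eq]
  constructor
  · rintro ⟨_, k, h₁, -, h₂⟩
    exact ⟨k, h₁, h₂⟩
  · rintro ⟨k, h₁, h₂⟩
    exact ⟨k, k, h₁, by omega, h₂⟩

omit [Fintype V] [DecidableEq V] mΩ in
theorem mem_redOnceGnosticWithin_zero {v : V} {t : ℕ} {ω : Ω} :
    ω ∈ redOnceGnosticWithin S v 0 t ↔ S t ω v = .red := by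
  constructor
  · rintro ⟨k, h₁, h₂, h₃, -⟩
    obtain rfl : k = t := by omega
    exact h₃
  · exact fun h => ⟨t, le_rfl, le_rfl, h, fun j _ _ => by omega⟩

omit [Fintype V] [DecidableEq V] mΩ in
theorem mem_redOnceGnosticWithin_succ {v : V} {n t : ℕ} {ω : Ω} :
    ω ∈ redOnceGnosticWithin S v (n + 1) t ↔
      S t ω v = .red ∨ S t ω v = .agnostic ∧ ω ∈ redOnceGnosticWithin S v n (t + 1) := by
  constructor
  · rintro ⟨k, h₁, h₂, h₃, h₄⟩
    obtain rfl | h₁ := h₁.eq_or_lt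
    · exact .inl h₃
    · exact .inr ⟨h₄ t le_rfl h₁, k, h₁, by omega, h₃, fun j hj => h₄ j (by omega)⟩
  · rintro (h | ⟨h, k, h₁, h₂, h₃, h₄⟩)
    · exact ⟨t, le_rfl, by omega, h, fun j _ _ => by omega⟩
    · refine ⟨k, by omega, by omega, h₃, fun j hj hjk => ?_⟩
      obtain rfl | hj := hj.eq_or_lt
      exacts [h, h₄ j hj hjk]

/-- Induction on `n` for all `t` at once. Conditioning on the whole history lets the tower property
link times `t` and `t + 1`. -/
theorem condExp_redOnceGnosticWithin (hS : IsVoterModel H π P S) (v : V) (n t : ℕ) :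
    P⟦redOnceGnosticWithin S v n t | history S hS.measurable t⟧ =ᵐ[P]
      fun ω => redProbWithin H π v n (S t ω) := by
  have hsm : ∀ (f : Config V → ℝ) t,
      StronglyMeasurable[history S hS.measurable t] fun ω => f (S t ω) := fun f t =>
    (stronglyMeasurable_sigmaAt_comp S f t).mono (sigmaAt_le_history hS.measurable t)
  have hint := integrable_comp (P := P) hS.measurable
  have hle := (history S hS.measurable).le
  induction n generalizing t with
  | zero =>
    have h : (redOnceGnosticWithin S v 0 t).indicator (fun _ => (1 : ℝ)) =
        fun ω => redProbWithin H π v 0 (S t ω) := by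
      funext ω
      simp [Set.indicator, mem_redOnceGnosticWithin_zero, redProbWithin]
    rw [h, condExp_of_stronglyMeasurable (hle t) (hsm _ t) (hint _ t)]
  | succ n ih =>
    let r : Config V → ℝ := fun s => if s v = .red then 1 else 0
    let a : Config V → ℝ := fun s => if s v = .agnostic then 1 else 0
    let A : Ω → ℝ := (redOnceGnosticWithin S v n (t + 1)).indicator fun _ => 1
    have hA : Integrable A P := (integrable_const 1).indicator
      (measurableSet_redOnceGnosticWithin hS.measurable v n (t + 1))
    -- Either `v` is red now, or it is agnostic now and the event with horizon `n` holds from time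
    -- `t + 1`. The factors `r` and `a` are known at time `t`.
    have h : (redOnceGnosticWithin S v (n + 1) t).indicator (fun _ => (1 : ℝ)) =
        (fun ω => r (S t ω)) + (fun ω => a (S t ω)) * A := by
      funext ω
      have hmem := mem_redOnceGnosticWithin_succ (S := S) (v := v) (n := n) (t := t) (ω := ω)
      by_cases hn : ω ∈ redOnceGnosticWithin S v n (t + 1) <;> cases hs : S t ω v <;>
        simp only [hs, hn, reduceCtorEq, false_or, and_self, and_false, or_false, false_and,
          iff_true, iff_false] at hmem <;>
        simp [hmem, hn, hs, r, a, A]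
    have haA : Integrable ((fun ω => a (S t ω)) * A) P := by
      refine hA.bdd_mul (c := 1) (hint a t).aestronglyMeasurable (ae_of_all _ fun ω => ?_)
      simp only [a]
      split_ifs <;> simp
    have hnext : P[A | history S hS.measurable t] =ᵐ[P]
        fun ω => stepMean H π (redProbWithin H π v n) (S t ω) :=
      (condExp_condExp_of_le ((history S hS.measurable).mono t.le_succ) (hle (t + 1))).symm.trans
        ((condExp_congr_ae (ih (t + 1))).trans (condExp_comp_succ hS _ t))
    rw [h]
    filter_upwards [condExp_add (hint r t) haA (history S hS.measurable t),
      condExp_mul_of_stronglyMeasurable_left (hsm a t) haA hA, hnext] with ω h₁ h₂ h₃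
    rw [h₁, Pi.add_apply, h₂, Pi.mul_apply, h₃,
      condExp_of_stronglyMeasurable (hle t) (hsm r t) (hint r t)]
    cases hs : S t ω v <;> simp [redProbWithin, r, a, hs]

/-- Dominated convergence in the horizon `n`, after the tower property reduces the history to `S t`.
-/
theorem condExp_redOnceGnostic (hS : IsVoterModel H π P S) (hH : ∀ v u, 0 ≤ H v u)
    (hrow : ∀ v, ∑ u, H v u = 1) (v : V) (t : ℕ) :
    P⟦redOnceGnostic S t v | sigmaAt S t⟧ =ᵐ[P] fun ω => redProb H π v (S t ω) := by
  have hint := integrable_comp (P := P) hS.measurable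
  have hmeas := fun n => measurableSet_redOnceGnosticWithin hS.measurable v n t
  have hmono : Monotone fun n => redOnceGnosticWithin S v n t := by
    rintro n n' hn ω ⟨k, h₁, h₂, h₃⟩
    exact ⟨k, h₁, by omega, h₃⟩
  have hle : sigmaAt S t ≤ mΩ := (hS.measurable t).comap_le
  have key : P⟦redOnceGnostic S t v | sigmaAt S t⟧ =ᵐ[P]
      P[fun ω => redProb H π v (S t ω) | sigmaAt S t] := by
    refine tendsto_condExp_unique
      (fun n => (redOnceGnosticWithin S v n t).indicator fun _ => (1 : ℝ))
      (fun n ω => redProbWithin H π v n (S t ω)) _ _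
      (fun n => (integrable_const 1).indicator (hmeas n)) (fun n => hint _ t)
      (ae_of_all _ fun ω => ?_) (ae_of_all _ fun ω => tendsto_redProbWithin hH hrow v _)
      (fun _ => 1) (integrable_const 1) (fun _ => 1) (integrable_const 1)
      (fun n => ae_of_all _ fun ω => ?_) (fun n => ae_of_all _ fun ω => ?_) (fun n => ?_)
    · rw [← iUnion_redOnceGnosticWithin]
      exact (hmono.tendsto_indicator _ _ ω).mono_right (pure_le_nhds _)
    · refine (norm_indicator_le_norm_self _ _).trans ?_
      simp
    · rw [Real.norm_of_nonneg (redProbWithin_nonneg hH v n _)]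
      exact redProbWithin_le_one hH hrow v n _
    · exact (condExp_condExp_of_le (sigmaAt_le_history hS.measurable t)
        ((history S hS.measurable).le t)).symm.trans
          (condExp_congr_ae (condExp_redOnceGnosticWithin hS v n t))
  rwa [condExp_of_stronglyMeasurable hle (stronglyMeasurable_sigmaAt_comp S _ t) (hint _ t)]
    at key

/-! ### The martingale and the probability of a red win -/

theorem redInfluence_ae_eq (hS : IsVoterModel H π P S) (hH : ∀ v u, 0 ≤ H v u)
    (hrow : ∀ v, ∑ u, H v u = 1) (μ : V → ℝ) (t : ℕ) :
    redInfluence μ P S t =ᵐ[P] fun ω => ∑ v, μ v * redProb H π v (S t ω) := by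
  filter_upwards [ae_all_iff.2 fun v => condExp_redOnceGnostic hS hH hrow v t] with ω hω
  simp only [redInfluence, hω]

theorem martingale_redInfluence (hS : IsVoterModel H π P S) (hH : ∀ v u, 0 ≤ H v u)
    (hrow : ∀ v, ∑ u, H v u = 1) {μ : V → ℝ} (hrev : ∀ v w, H v w * μ v = H w v * μ w) :
    Martingale (redInfluence μ P S) (history S hS.measurable) P := by
  have hX := redInfluence_ae_eq hS hH hrow μ
  refine martingale_nat (fun t => ?_) (fun t => ?_) fun t => ?_
  · refine Finset.stronglyMeasurable_fun_sum _ fun v _ => ?_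
    exact (stronglyMeasurable_condExp.mono (sigmaAt_le_history hS.measurable t)).const_mul _
  · exact (integrable_comp hS.measurable (fun s => ∑ v, μ v * redProb H π v s) t).congr
      (hX t).symm
  · refine (hX t).trans (((condExp_congr_ae (hX (t + 1))).trans
      (condExp_comp_succ hS (fun s => ∑ v, μ v * redProb H π v s) t)).trans ?_).symm
    exact ae_of_all _ fun ω => stepMean_sum_mul_redProb hH hrow hrev _

omit [DecidableEq V] in
theorem measurableSet_redWins (hm : ∀ t, Measurable (S t)) : MeasurableSet (redWins S) := by
  simp only [redWins, Set.ofPred_exists, Set.ofPred_forall]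
  exact .iUnion fun t => .iInter fun v =>
    (measurable_pi_apply v).comp (hm t) (measurableSet_singleton Opinion.red)

/-- Once consensus is reached, the red influence is the indicator of a red win. -/
theorem ae_eventually_sum_mul_redProb_eq [Nonempty V] (hS : IsVoterModel H π P S)
    {μ : V → ℝ} (hμ : ∑ v, μ v = 1) (hconv : Converges P S) :
    ∀ᵐ ω ∂P, ∀ᶠ t in atTop, ∑ v, μ v * redProb H π v (S t ω) =
      (redWins S).indicator (fun _ => 1) ω := by
  filter_upwards [hconv, ae_stepProb_ne_zero hS] with ω ⟨t₀, c, hc⟩ hstep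
  have habs : ∀ (c : Opinion) (t : ℕ), (∀ v, S t ω v = c) → ∀ t' ≥ t, S t' ω = fun _ => c := by
    intro c t ht t' htt'
    induction t', htt' using Nat.le_induction with
    | base => exact funext ht
    | succ k _ ih =>
      refine eq_const_of_stepProb_ne_zero (H := H) (π := π) ?_
      rw [← ih]
      exact hstep k
  -- Two consensus states on the same trajectory are compared at the later of their times.
  have hwin : ω ∈ redWins S ↔ c = .red := by
    constructor
    · rintro ⟨t, ht⟩
      have h := (habs c t₀ hc (max t t₀) (le_max_right _ _)).symm.trans
        (habs .red t ht (max t t₀) (le_max_left _ _))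
      exact congrFun h (Classical.arbitrary V)
    · rintro rfl
      exact ⟨t₀, hc⟩
  filter_upwards [eventually_ge_atTop t₀] with t ht
  simp only [habs c t₀ hc t ht, redProb_const, ← Finset.sum_mul, hμ, one_mul, Set.indicator,
    hwin]

theorem condExp_redWins (hS : IsVoterModel H π P S) (hH : ∀ v u, 0 ≤ H v u)
    (hrow : ∀ v, ∑ u, H v u = 1) {μ : V → ℝ} (hrev : ∀ v w, H v w * μ v = H w v * μ w)
    (hμ : ∑ v, μ v = 1) (hconv : Converges P S) :
    P⟦redWins S | sigmaAt S 0⟧ =ᵐ[P] redInfluence μ P S 0 := by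
  have : Nonempty V := by
    by_contra h
    rw [not_nonempty_iff] at h
    simp at hμ
  have hX := redInfluence_ae_eq hS hH hrow μ
  have hmart := martingale_redInfluence hS hH hrow hrev
  have hle : sigmaAt S 0 ≤ mΩ := (hS.measurable 0).comap_le
  let h : Config V → ℝ := fun s => ∑ v, μ v * redProb H π v s
  have hint := fun t => integrable_comp (P := P) hS.measurable h t
  have hself : P[fun ω => h (S 0 ω) | sigmaAt S 0] = fun ω => h (S 0 ω) :=
    condExp_of_stronglyMeasurable hle (stronglyMeasurable_sigmaAt_comp S h 0) (hint 0)
  -- `μ` may have negative entries, so the dominating constant comes from the finiteness of the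
  -- configuration space.
  have hbound : ∀ s, ‖h s‖ ≤ ∑ s', ‖h s'‖ := fun s =>
    Finset.single_le_sum (f := fun s => ‖h s‖) (fun _ _ => norm_nonneg _) (Finset.mem_univ s)
  -- All `h (S n)` have the same conditional expectation given `S 0` as the constant sequence `h (S
  -- 0)`, so the limits do too.
  have key : P⟦redWins S | sigmaAt S 0⟧ =ᵐ[P] P[fun ω => h (S 0 ω) | sigmaAt S 0] := by
    refine tendsto_condExp_unique (fun n ω => h (S n ω)) (fun _ ω => h (S 0 ω)) _ _
      hint (fun _ => hint 0) ?_ (ae_of_all _ fun ω => tendsto_const_nhds)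
      (fun _ => ∑ s', ‖h s'‖) (integrable_const _) (fun _ => ∑ s', ‖h s'‖) (integrable_const _)
      (fun n => ae_of_all _ fun ω => hbound _) (fun n => ae_of_all _ fun ω => hbound _)
      (fun n => ?_)
    · filter_upwards [ae_eventually_sum_mul_redProb_eq hS hμ hconv] with ω hω
      exact tendsto_nhds_of_eventually_eq hω
    · refine (condExp_condExp_of_le (sigmaAt_le_history hS.measurable 0)
        ((history S hS.measurable).le 0)).symm.trans (condExp_congr_ae ?_)
      exact (condExp_congr_ae (hX n).symm).trans
        ((hmart.condExp_ae_eq n.zero_le).trans (hX 0))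
  rw [hself] at key
  exact key.trans (hX 0).symm

theorem ae_measureReal_redWins_eq (hS : IsVoterModel H π P S) (hH : ∀ v u, 0 ≤ H v u)
    (hrow : ∀ v, ∑ u, H v u = 1) {μ : V → ℝ} (hrev : ∀ v w, H v w * μ v = H w v * μ w)
    (hμ : ∑ v, μ v = 1) (hconv : Converges P S) {s₀ : Config V} (hs₀ : ∀ᵐ ω ∂P, S 0 ω = s₀) :
    ∀ᵐ ω ∂P, P.real (redWins S) = redInfluence μ P S 0 ω := by
  have hX : redInfluence μ P S 0 =ᵐ[P] fun _ => ∑ v, μ v * redProb H π v s₀ := by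
    filter_upwards [redInfluence_ae_eq hS hH hrow μ 0, hs₀] with ω h₁ h₂
    rw [h₁, h₂]
  have hP : P.real (redWins S) = ∑ v, μ v * redProb H π v s₀ := by
    have hle : sigmaAt S 0 ≤ mΩ := (hS.measurable 0).comap_le
    rw [← integral_indicator_one (measurableSet_redWins hS.measurable)]
    change ∫ ω, (redWins S).indicator (fun _ => (1 : ℝ)) ω ∂P = _
    rw [← integral_condExp hle,
      integral_congr_ae ((condExp_redWins hS hH hrow hrev hμ hconv).trans hX)]
    simp
  filter_upwards [hX] with ω hω
  rw [hP, hω]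

end Chain

end AgnosticVoter

theorem AgnosticVoter.IsOutMatrix.nonneg {V : Type*} [Fintype V] {G : Digraph V}
    {H : Matrix V V ℝ} (hH : AgnosticVoter.IsOutMatrix G H) (v u : V) : 0 ≤ H v u := by
  by_cases h : G.Adj v u
  exacts [(hH.pos_of_adj v u h).le, (hH.zero_of_not_adj v u h).ge]

theorem theorem1 {V Ω : Type*} [Fintype V] [DecidableEq V] [MeasurableSpace Ω]
    (P : Measure Ω) [IsProbabilityMeasure P]
    (G : Digraph V) (H : Matrix V V ℝ) (hH : AgnosticVoter.IsOutMatrix G H)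
    (μ : V → ℝ) (hμ : Matrix.vecMul μ H = μ)
    (hrev : ∀ v w, H v w * μ v = H w v * μ w)
    (π : AgnosticVoter.Protocol) (S : ℕ → Ω → AgnosticVoter.Config V)
    (hS : AgnosticVoter.IsVoterModel H π P S) :
    Martingale (AgnosticVoter.redInfluence μ P S) (AgnosticVoter.history S hS.measurable) P ∧
    (∑ v, μ v = 1 → AgnosticVoter.Converges P S →
      P⟦AgnosticVoter.redWins S | AgnosticVoter.sigmaAt S 0⟧
          =ᵐ[P] AgnosticVoter.redInfluence μ P S 0 ∧
      ∀ s₀ : AgnosticVoter.Config V, (∀ᵐ ω ∂P, S 0 ω = s₀) →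
        ∀ᵐ ω ∂P, P.real (AgnosticVoter.redWins S) = AgnosticVoter.redInfluence μ P S 0 ω) :=
  ⟨AgnosticVoter.martingale_redInfluence hS hH.nonneg hH.sum_row hrev, fun hsum hconv =>
    ⟨AgnosticVoter.condExp_redWins hS hH.nonneg hH.sum_row hrev hsum hconv, fun _ hs₀ =>
      AgnosticVoter.ae_measureReal_redWins_eq hS hH.nonneg hH.sum_row hrev hsum hconv hs₀⟩⟩
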